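/- Order $\mathbb{R}^n$ coordinatewise, write $\lambda+x=(\lambda+x_i)_i$, and let $\mathbb{R}_{\max}=\mathbb{R}\cup\{-\infty\}$ (with the topology of the metric $|e^a-e^b|$) and $\mathbb{R}_{\min}=\mathbb{R}\cup\{+\infty\}$ (with the topology of the metric $|e^{-a}-e^{-b}|$). An *ambitropical cone* is a nonempty set $C\subset\mathbb{R}^n$ such that $\lambda+x\in C$ for all $x\in C$, $\lambda\in\mathbb{R}$, and such that $C$ is a lattice in the induced order (not necessarily a sublattice of $\mathbb{R}^n$). An *alcoved polyhedron* is a set $\{x\in\mathbb{R}^n\mid x_i\ge M_{ij}+x_j\ \forall i,j\}$ with $M\in\mathbb{R}_{\max}^{n\times n}$. An *ambitropical polyhedron* is an ambitropical cone that is a finite union of alcoved polyhedra; it is an *ambitropical polytope* if moreover it is bounded in Hilbert's seminorm $\max_i x_i-\min_i x_i$. An *ambitropical hull* of $E\subset\mathbb{R}^n$ is a closed ambitropical cone containing $E$ that is minimal for inclusion among the closed ambitropical cones containing $E$. For nonempty $E\subset\mathbb{R}^n$, let $E^{\max}\subset\mathbb{R}^n$ be the set of vectors $\sup_{f\in E}(\lambda_f+f)$,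 where $\lambda_f\in\mathbb{R}_{\max}$ are not all $-\infty$ and the family $(\lambda_f+f)_{f\in E}$ is bounded from above, and let $\bar E^{\max}\subset\mathbb{R}_{\max}^n$ be the set of limits of nonincreasing sequences of elements of $E^{\max}$. Dually, let $E^{\min}\subset\mathbb{R}^n$ be the set of vectors $\inf_{f\in E}(\lambda_f+f)$, where $\lambda_f\in\mathbb{R}_{\min}$ are not all $+\infty$ and the family is bounded from below, and let $\bar E^{\min}\subset\mathbb{R}_{\min}^n$ be the set of limits of nondecreasing sequences of elements of $E^{\min}$. A *description by generators* of a closed ambitropical cone $E$ is a pair $(U^{\max},U^{\min})$ with $U^{\max}\subset\bar E^{\max}$ and $U^{\min}\subset\bar E^{\min}$ such that every element of $\bar E^{\max}$ is a finite max-plus linear combination (coefficients in $\mathbb{R}_{\max}$) of elements of $U^{\max}$, and every element of $\bar E^{\min}$ is a finite min-plus linear combination (coefficients in $\mathbb{R}_{\min}$) of elements of $U^{\min}$. It is *finite* if both sets are finite. Then: 1. A closed ambitropical cone $C$ is an ambitropical polyhedron if and only if it has a finite description by generators. 2. A closed ambitropical cone $C$ is an ambitropical polytope if and only if it has a finite description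 by generators $(U^{\max},U^{\min})$ with $U^{\max},U^{\min}\subset\mathbb{R}^n$. More precisely, for every finite description by generators $(U^{\max},U^{\min})$ of $C$, the cone $C$ is an ambitropical polytope if and only if all elements of $U^{\max}$ other than $(-\infty,\dots,-\infty)$ and all elements of $U^{\min}$ other than $(+\infty,\dots,+\infty)$ belong to $\mathbb{R}^n$. 3. Every finite subset of $\mathbb{R}^n$ has an ambitropical hull that is an ambitropical polytope, and every ambitropical polytope is an ambitropical hull of some finite subset of $\mathbb{R}^n$. -/

import Mathlib

open Filter Topology

noncomputable section

namespace Ambitropical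

/-- An additive cone: a subset of `ℝⁿ` invariant under translation by constant vectors. -/
def IsAdditiveCone {n : ℕ} (C : Set (Fin n → ℝ)) : Prop :=
  ∀ x ∈ C, ∀ r : ℝ, (fun i => r + x i) ∈ C

/-- An ambitropical cone: a nonempty additive cone that is a lattice for the order induced by the
coordinatewise order of `ℝⁿ` (joins and meets are taken inside `C`; `C` need not be a sublattice
of `ℝⁿ`). -/
def IsAmbitropicalCone {n : ℕ} (C : Set (Fin n → ℝ)) : Prop :=
  C.Nonempty ∧ IsAdditiveCone C ∧
    ∀ x y : C, (∃ z : C, IsLUB {x, y} z) ∧ (∃ z : C, IsGLB {x, y} z)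

/-- An alcoved polyhedron (of type `A_n`):
`{x ∈ ℝⁿ | xᵢ ≥ Mᵢⱼ + xⱼ for all i, j}` for a matrix `M` with entries in `ℝ ∪ {-∞}`. -/
def IsAlcovedPolyhedron {n : ℕ} (P : Set (Fin n → ℝ)) : Prop :=
  ∃ M : Matrix (Fin n) (Fin n) (WithBot ℝ),
    P = {x | ∀ i j, M i j + (x j : WithBot ℝ) ≤ (x i : WithBot ℝ)}

/-- An ambitropical polyhedron: an ambitropical cone that is a finite union of alcoved
polyhedra. -/
def IsAmbitropicalPolyhedron {n : ℕ} (C : Set (Fin n → ℝ)) : Prop :=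
  IsAmbitropicalCone C ∧
    ∃ S : Set (Set (Fin n → ℝ)), S.Finite ∧ (∀ P ∈ S, IsAlcovedPolyhedron P) ∧ C = ⋃₀ S

/-- Hilbert's seminorm `max xᵢ - min xᵢ`. -/
def hilbertSeminorm {n : ℕ} (x : Fin n → ℝ) : ℝ := (⨆ i, x i) - ⨅ i, x i

/-- An ambitropical polytope: an ambitropical polyhedron bounded in Hilbert's seminorm. -/
def IsAmbitropicalPolytope {n : ℕ} (C : Set (Fin n → ℝ)) : Prop :=
  IsAmbitropicalPolyhedron C ∧ ∃ R : ℝ, ∀ x ∈ C, hilbertSeminorm x ≤ R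

/-- An ambitropical hull of `E`: a closed ambitropical cone containing `E` that is minimal, with
respect to inclusion, among the closed ambitropical cones containing `E`. -/
def IsAmbitropicalHull {n : ℕ} (E H : Set (Fin n → ℝ)) : Prop :=
  Minimal (fun F : Set (Fin n → ℝ) => IsClosed F ∧ IsAmbitropicalCone F ∧ E ⊆ F) H

/-- The inclusion of `ℝⁿ` into `(ℝ ∪ {-∞})ⁿ`. -/
def toMax {n : ℕ} (x : Fin n → ℝ) : Fin n → WithBot ℝ := fun i => (x i : WithBot ℝ)

/-- The inclusion of `ℝⁿ` into `(ℝ ∪ {+∞})ⁿ`. -/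
def toMin {n : ℕ} (x : Fin n → ℝ) : Fin n → WithTop ℝ := fun i => (x i : WithTop ℝ)

/-- `E^max`: the vectors of `ℝⁿ` that are suprema `sup_{f ∈ E} (λ_f + f)` of families that are
bounded from above, with coefficients in `ℝ ∪ {-∞}` that are not all equal to `-∞`. -/
def maxHull {n : ℕ} (E : Set (Fin n → ℝ)) : Set (Fin n → ℝ) :=
  {x | ∃ c : (Fin n → ℝ) → WithBot ℝ, (∃ f ∈ E, c f ≠ ⊥) ∧
    IsLUB ((fun f i => c f + toMax f i) '' E) (toMax x)}

/-- `E^min`: the vectors of `ℝⁿ` that are infima `inf_{f ∈ E} (λ_f + f)` of families that are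
bounded from below, with coefficients in `ℝ ∪ {+∞}` that are not all equal to `+∞`. -/
def minHull {n : ℕ} (E : Set (Fin n → ℝ)) : Set (Fin n → ℝ) :=
  {x | ∃ c : (Fin n → ℝ) → WithTop ℝ, (∃ f ∈ E, c f ≠ ⊤) ∧
    IsGLB ((fun f i => c f + toMin f i) '' E) (toMin x)}

/-- The exponential map `ℝ ∪ {-∞} → ℝ`; the topology of `ℝ ∪ {-∞}` is that of the metric
`|exp a - exp b|`. -/
def expMax : WithBot ℝ → ℝ := WithBot.recBotCoe 0 Real.exp

/-- The map `a ↦ exp (-a)` from `ℝ ∪ {+∞}` to `ℝ`; the topology of `ℝ ∪ {+∞}` is that of the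
metric `|exp (-a) - exp (-b)|`. -/
def expMin : WithTop ℝ → ℝ := WithTop.recTopCoe 0 (fun r => Real.exp (-r))

/-- The lower closure of `C`: limits in `(ℝ ∪ {-∞})ⁿ` of nonincreasing sequences of `C`. -/
def tropLowerClosure {n : ℕ} (C : Set (Fin n → ℝ)) : Set (Fin n → WithBot ℝ) :=
  {y | ∃ u : ℕ → Fin n → ℝ, (∀ k, u k ∈ C) ∧ Antitone u ∧
    ∀ i, Tendsto (fun k => expMax (toMax (u k) i)) atTop (𝓝 (expMax (y i)))}

/-- The upper closure of `C`: limits in `(ℝ ∪ {+∞})ⁿ` of nondecreasing sequences of `C`. -/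
def tropUpperClosure {n : ℕ} (C : Set (Fin n → ℝ)) : Set (Fin n → WithTop ℝ) :=
  {y | ∃ u : ℕ → Fin n → ℝ, (∀ k, u k ∈ C) ∧ Monotone u ∧
    ∀ i, Tendsto (fun k => expMin (toMin (u k) i)) atTop (𝓝 (expMin (y i)))}

/-- `G` is a tropical generating set of `V`: `G ⊆ V`, and every element of `V` is a finite
max-plus linear combination of elements of `G`. -/
def IsTropicalGeneratingSet {n : ℕ} (G V : Set (Fin n → WithBot ℝ)) : Prop :=
  G ⊆ V ∧ ∀ v ∈ V, ∃ (m : ℕ) (c : Fin m → WithBot ℝ) (a : Fin m → Fin n → WithBot ℝ),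
    (∀ k, a k ∈ G) ∧ v = fun i => Finset.univ.sup fun k => c k + a k i

/-- `G` is a dual tropical generating set of `V`: `G ⊆ V`, and every element of `V` is a finite
min-plus linear combination of elements of `G`. -/
def IsDualTropicalGeneratingSet {n : ℕ} (G V : Set (Fin n → WithTop ℝ)) : Prop :=
  G ⊆ V ∧ ∀ v ∈ V, ∃ (m : ℕ) (c : Fin m → WithTop ℝ) (a : Fin m → Fin n → WithTop ℝ),
    (∀ k, a k ∈ G) ∧ v = fun i => Finset.univ.inf fun k => c k + a k i

/-- `(U, V)` is a description by generators of `E`. -/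
def IsDescriptionByGenerators {n : ℕ} (E : Set (Fin n → ℝ))
    (U : Set (Fin n → WithBot ℝ)) (V : Set (Fin n → WithTop ℝ)) : Prop :=
  IsTropicalGeneratingSet U (tropLowerClosure (maxHull E)) ∧
    IsDualTropicalGeneratingSet V (tropUpperClosure (minHull E))

/-- A finite description by generators. -/
def IsFiniteDescription {n : ℕ} (E : Set (Fin n → ℝ))
    (U : Set (Fin n → WithBot ℝ)) (V : Set (Fin n → WithTop ℝ)) : Prop :=
  IsDescriptionByGenerators E U V ∧ U.Finite ∧ V.Finite

end Ambitropical

end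

/-! A vector y is a finite max-plus combination of generators exactly when, at each finite
coordinate i, some generator translated to agree with y at i lies below y
(`exists_combination_iff_isSelected`). For finitely many generators, the real vectors with this
property form a finite union of alcoved polyhedra. A closed ambitropical cone is recovered from its
two hulls: if elements of C approximate x from both sides, the join in C of the lower approximants
is trapped under the upper ones, hence close to x (`mem_of_approximations`). So a finite description
exhibits C as a finite union of alcoved polyhedra.

Conversely, a nonempty alcoved polyhedron has, for each coordinate j, the generator inf (x - x_j)
(`IsAlcovedPolyhedron.exists_generator`). Finitely many such vectors touch every point of C from
below at every coordinate, and by closedness they generate the completed max-plus hull. Min-plus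
statements follow by negation. Hilbert bounds pass between points and generators through coordinate
differences.

A hull of a nonempty finite set (n > 0) is the fixed-point set of the min-plus projection composed
with the max-plus one, a min-max map. A polytope is in turn the hull of its real generators of both
kinds. -/

namespace Ambitropical

/-! ### Exponential coordinates on ℝ ∪ {-∞} -/

section Exponential

@[simp] theorem expMax_bot : expMax ⊥ = 0 := rfl

@[simp] theorem expMax_coe (r : ℝ) : expMax (r : WithBot ℝ) = Real.exp r := rfl

theorem expMax_toMax {n : ℕ} (x : Fin n → ℝ) (i : Fin n) :
    expMax (toMax x i) = Real.exp (x i) := rfl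

theorem expMax_nonneg (a : WithBot ℝ) : 0 ≤ expMax a := by
  induction a with
  | bot => simp
  | coe r => simpa using (Real.exp_pos r).le

theorem expMax_pos {a : WithBot ℝ} (h : a ≠ ⊥) : 0 < expMax a := by
  induction a with
  | bot => exact absurd rfl h
  | coe r => simpa using Real.exp_pos r

theorem expMax_add (a b : WithBot ℝ) : expMax (a + b) = expMax a * expMax b := by
  induction a with
  | bot => simp
  | coe r =>
    induction b with
    | bot => simp
    | coe s => exact Real.exp_add r s

theorem expMax_le_expMax {a b : WithBot ℝ} : expMax a ≤ expMax b ↔ a ≤ b := by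
  induction a with
  | bot => simpa using expMax_nonneg b
  | coe r =>
    induction b with
    | bot => simpa using Real.exp_pos r
    | coe s => simp

theorem exists_expMax_eq {r : ℝ} (hr : 0 ≤ r) : ∃ a, expMax a = r := by
  rcases hr.eq_or_lt with rfl | h
  · exact ⟨⊥, rfl⟩
  · exact ⟨(Real.log r : ℝ), by simp [Real.exp_log h]⟩

theorem exists_tendsto_expMax {n : ℕ} {u : ℕ → Fin n → ℝ} (hu : Antitone u) :
    ∃ g : Fin n → WithBot ℝ,
      ∀ i, Tendsto (fun k => expMax (toMax (u k) i)) atTop (𝓝 (expMax (g i))) := by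
  have key : ∀ i, ∃ a : WithBot ℝ,
      Tendsto (fun k => expMax (toMax (u k) i)) atTop (𝓝 (expMax a)) := fun i => by
    have ha : Antitone fun k => expMax (toMax (u k) i) := fun k l h => by
      simpa [expMax_toMax] using hu h i
    have hb : BddBelow (Set.range fun k => expMax (toMax (u k) i)) :=
      ⟨0, by rintro _ ⟨k, rfl⟩; exact expMax_nonneg _⟩
    obtain ⟨a, ha'⟩ := exists_expMax_eq (r := ⨅ k, expMax (toMax (u k) i))
      (le_ciInf fun k => expMax_nonneg _)
    exact ⟨a, ha' ▸ tendsto_atTop_ciInf ha hb⟩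
  choose g hg using key
  exact ⟨g, hg⟩

end Exponential

/-! ### Max-plus and min-plus hulls of additive cones -/

section Hulls

variable {n : ℕ} {C : Set (Fin n → ℝ)}

/-- Coefficients can be absorbed into C by translation, so x is a supremum of the family exactly
when the elements of C below x have supremum x. -/
theorem mem_maxHull_iff (hC : IsAdditiveCone C) (hne : C.Nonempty) {x : Fin n → ℝ} :
    x ∈ maxHull C ↔ ∀ i, ∀ ε > 0, ∃ f ∈ C, f ≤ x ∧ x i - ε ≤ f i := by
  constructor
  · rintro ⟨c, -, hub, hlub⟩ i ε hε
    by_contra! hcon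
    -- If no element of C below x comes within ε of x at i, lowering x by ε at i still gives an
    -- upper bound.
    have hb : (toMax (Function.update x i (x i - ε))) ∈
        upperBounds ((fun f i => c f + toMax f i) '' C) := by
      rintro _ ⟨f, hf, rfl⟩ j
      have hfx := hub ⟨f, hf, rfl⟩
      induction h : c f with
      | bot => simp [h]
      | coe r =>
        have hle : (fun j => r + f j) ≤ x := fun j => by
          have := hfx j
          simp only [h, toMax] at this
          exact WithBot.coe_le_coe.1 this
        have h1 := hcon _ (hC f hf r) hle
        simp only [h, toMax]
        rcases eq_or_ne j i with rfl | hji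
        · simp only [Function.update_self]
          exact WithBot.coe_le_coe.2 h1.le
        · rw [Function.update_of_ne hji]
          exact WithBot.coe_le_coe.2 (hle j)
    have := hlub hb i
    simp only [toMax, Function.update_self, WithBot.coe_le_coe] at this
    linarith
  · intro h
    classical
    refine ⟨fun f => if f ≤ x then 0 else ⊥, ?_, ?_, ?_⟩
    -- For n = 0 no coordinate supplies an element below x, so nonemptiness of C does.
    · rcases isEmpty_or_nonempty (Fin n) with _ | ⟨⟨i⟩⟩
      · obtain ⟨f, hf⟩ := hne
        exact ⟨f, hf, by simp [Subsingleton.elim f x]⟩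
      · obtain ⟨f, hf, hfx, -⟩ := h i 1 one_pos
        exact ⟨f, hf, by simp [hfx]⟩
    · rintro _ ⟨f, hf, rfl⟩ j
      by_cases hfx : f ≤ x
      · simpa [hfx, toMax] using hfx j
      · simp [hfx]
    · intro b hb i
      have h1 : ∀ ε > 0, ((x i - ε : ℝ) : WithBot ℝ) ≤ b i := fun ε hε => by
        obtain ⟨f, hf, hfx, hfi⟩ := h i ε hε
        have := hb ⟨f, hf, rfl⟩ i
        simp only [hfx, if_true, zero_add, toMax] at this
        exact le_trans (by exact_mod_cast hfi) this
      rcases hbi : b i with _ | r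
      · have := h1 1 one_pos
        rw [hbi] at this
        exact absurd (le_bot_iff.1 this) WithBot.coe_ne_bot
      · simp only [toMax]
        refine WithBot.coe_le_coe.2 (le_of_forall_pos_le_add fun ε hε => ?_)
        have := h1 ε hε
        rw [hbi] at this
        have := WithBot.coe_le_coe.1 this
        linarith

theorem mem_minHull_iff (hC : IsAdditiveCone C) (hne : C.Nonempty) {x : Fin n → ℝ} :
    x ∈ minHull C ↔ ∀ i, ∀ ε > 0, ∃ f ∈ C, x ≤ f ∧ f i ≤ x i + ε := by
  constructor
  · rintro ⟨c, -, hub, hlub⟩ i ε hε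
    by_contra! hcon
    have hb : (toMin (Function.update x i (x i + ε))) ∈
        lowerBounds ((fun f i => c f + toMin f i) '' C) := by
      rintro _ ⟨f, hf, rfl⟩ j
      have hfx := hub ⟨f, hf, rfl⟩
      induction h : c f with
      | top => simp [h]
      | coe r =>
        have hle : x ≤ (fun j => r + f j) := fun j => by
          have := hfx j
          simp only [h, toMin] at this
          exact WithTop.coe_le_coe.1 this
        have h1 := hcon _ (hC f hf r) hle
        simp only [h, toMin]
        rcases eq_or_ne j i with rfl | hji
        · simp only [Function.update_self]
          exact WithTop.coe_le_coe.2 h1.le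
        · rw [Function.update_of_ne hji]
          exact WithTop.coe_le_coe.2 (hle j)
    have := hlub hb i
    simp only [toMin, Function.update_self, WithTop.coe_le_coe] at this
    linarith
  · intro h
    classical
    refine ⟨fun f => if x ≤ f then 0 else ⊤, ?_, ?_, ?_⟩
    · rcases isEmpty_or_nonempty (Fin n) with _ | ⟨⟨i⟩⟩
      · obtain ⟨f, hf⟩ := hne
        exact ⟨f, hf, by simp [Subsingleton.elim f x]⟩
      · obtain ⟨f, hf, hfx, -⟩ := h i 1 one_pos
        exact ⟨f, hf, by simp [hfx]⟩
    · rintro _ ⟨f, hf, rfl⟩ j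
      by_cases hfx : x ≤ f
      · simpa [hfx, toMin] using hfx j
      · simp [hfx]
    · intro b hb i
      have h1 : ∀ ε > 0, b i ≤ ((x i + ε : ℝ) : WithTop ℝ) := fun ε hε => by
        obtain ⟨f, hf, hfx, hfi⟩ := h i ε hε
        have := hb ⟨f, hf, rfl⟩ i
        simp only [hfx, if_true, zero_add, toMin] at this
        exact le_trans this (by exact_mod_cast hfi)
      rcases hbi : b i with _ | r
      · have := h1 1 one_pos
        rw [hbi] at this
        exact absurd (top_le_iff.1 this) WithTop.coe_ne_top
      · simp only [toMin]
        refine WithTop.coe_le_coe.2 (le_of_forall_pos_le_add fun ε hε => ?_)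
        have := h1 ε hε
        rw [hbi] at this
        exact WithTop.coe_le_coe.1 this

theorem subset_maxHull (hC : IsAdditiveCone C) : C ⊆ maxHull C := fun x hx =>
  (mem_maxHull_iff hC ⟨x, hx⟩).2 fun i ε hε => ⟨x, hx, le_rfl, by linarith⟩

theorem tropLowerClosure_mono {A B : Set (Fin n → ℝ)} (h : A ⊆ B) :
    tropLowerClosure A ⊆ tropLowerClosure B := by
  rintro y ⟨u, hu, h'⟩
  exact ⟨u, fun k => h (hu k), h'⟩

theorem toMax_mem_tropLowerClosure {x : Fin n → ℝ} (hx : x ∈ C) :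
    toMax x ∈ tropLowerClosure C :=
  ⟨fun _ => x, fun _ => hx, antitone_const, fun _ => tendsto_const_nhds⟩

theorem mem_of_toMax_mem_tropLowerClosure (hC : IsClosed C) {x : Fin n → ℝ}
    (hx : toMax x ∈ tropLowerClosure C) : x ∈ C := by
  obtain ⟨u, hu, -, hlim⟩ := hx
  refine hC.mem_of_tendsto (b := atTop) (f := u) (tendsto_pi_nhds.2 fun i => ?_)
    (Eventually.of_forall hu)
  have := (hlim i).log (expMax_pos WithBot.coe_ne_bot).ne'
  simpa [expMax_toMax] using this

end Hulls

/-! ### Negation exchanges max-plus and min-plus -/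

section Duality

open scoped Pointwise

variable {n : ℕ} {C : Set (Fin n → ℝ)}

/-- The order-reversing bijection `a ↦ -a` from `ℝ ∪ {+∞}` to `ℝ ∪ {-∞}`. -/
noncomputable def negTop : WithTop ℝ → WithBot ℝ :=
  WithTop.recTopCoe ⊥ fun r => ((-r : ℝ) : WithBot ℝ)

@[simp] theorem negTop_top : negTop ⊤ = ⊥ := rfl

@[simp] theorem negTop_coe (r : ℝ) : negTop r = ((-r : ℝ) : WithBot ℝ) := rfl

theorem negTop_bijective : Function.Bijective negTop := by
  constructor
  · intro a b h
    induction a <;> induction b <;> simp_all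
  · intro a
    induction a with
    | bot => exact ⟨⊤, rfl⟩
    | coe r => exact ⟨((-r : ℝ) : WithTop ℝ), by rw [negTop_coe, neg_neg]⟩

theorem negTop_add (a b : WithTop ℝ) : negTop (a + b) = negTop a + negTop b := by
  induction a with
  | top => simp
  | coe r =>
    induction b with
    | top => simp
    | coe s => exact congrArg WithBot.some (neg_add r s)

theorem negTop_antitone : Antitone negTop := by
  intro a b h
  induction b with
  | top => simp
  | coe s =>
    induction a with
    | top => simp at h
    | coe r => simpa using h

theorem negTop_finset_inf {m : ℕ} (s : Finset (Fin m)) (f : Fin m → WithTop ℝ) :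
    negTop (s.inf f) = s.sup fun k => negTop (f k) := by
    classical
    induction s using Finset.induction_on with
    | empty => simp
    | insert a s ha ih => rw [Finset.inf_insert, Finset.sup_insert, negTop_antitone.map_inf, ih]

theorem expMax_negTop (a : WithTop ℝ) : expMax (negTop a) = expMin a := by
  induction a <;> rfl

/-- The coordinatewise version of `negTop`. -/
noncomputable def negVec (v : Fin n → WithTop ℝ) : Fin n → WithBot ℝ := fun i => negTop (v i)

theorem negVec_bijective : Function.Bijective (negVec (n := n)) :=
  ⟨fun v w h => funext fun i => negTop_bijective.1 (congrFun h i), fun v => by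
    choose f hf using fun i => negTop_bijective.2 (v i)
    exact ⟨f, funext hf⟩⟩

theorem negVec_toMin (x : Fin n → ℝ) : negVec (toMin x) = toMax (-x) := rfl

theorem negVec_eq_bot {v : Fin n → WithTop ℝ} : negVec v = ⊥ ↔ v = ⊤ :=
  ⟨fun h => negVec_bijective.1 h, fun h => h ▸ rfl⟩

theorem negVec_mem_range_toMax {v : Fin n → WithTop ℝ} :
    negVec v ∈ Set.range toMax ↔ v ∈ Set.range toMin := by
  constructor
  · rintro ⟨x, hx⟩
    exact ⟨-x, negVec_bijective.1 (by rw [negVec_toMin, neg_neg, hx])⟩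
  · rintro ⟨x, rfl⟩
    exact ⟨-x, rfl⟩

theorem IsAdditiveCone.neg (hC : IsAdditiveCone C) : IsAdditiveCone (-C) := by
  intro x hx r
  have := hC (-x) hx (-r)
  rw [Set.mem_neg]
  convert this using 1
  ext i
  simp [add_comm]

theorem neg_mem_maxHull_neg (hC : IsAdditiveCone C) (hne : C.Nonempty) {x : Fin n → ℝ} :
    -x ∈ maxHull (-C) ↔ x ∈ minHull C := by
  rw [mem_maxHull_iff hC.neg hne.neg, mem_minHull_iff hC hne]
  refine forall_congr' fun i => forall₂_congr fun ε hε => ⟨?_, ?_⟩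
  · rintro ⟨f, hf, hfx, hfi⟩
    exact ⟨-f, hf, le_neg_of_le_neg hfx, by simp at hfi ⊢; linarith⟩
  · rintro ⟨f, hf, hfx, hfi⟩
    exact ⟨-f, by simpa using hf, neg_le_neg hfx, by simp at hfi ⊢; linarith⟩

theorem negVec_mem_tropLowerClosure_iff {A B : Set (Fin n → ℝ)} (h : ∀ x, -x ∈ A ↔ x ∈ B)
    {v : Fin n → WithTop ℝ} : negVec v ∈ tropLowerClosure A ↔ v ∈ tropUpperClosure B := by
  constructor
  · rintro ⟨u, hu, ha, hl⟩
    refine ⟨-u, fun k => (h _).1 (by simpa using hu k), ha.neg, fun i => ?_⟩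
    have := hl i
    rw [negVec, expMax_negTop] at this
    refine this.congr fun k => ?_
    change Real.exp (u k i) = Real.exp (-(-u k i))
    rw [neg_neg]
  · rintro ⟨u, hu, ha, hl⟩
    refine ⟨-u, fun k => (h _).2 (hu k), ha.neg, fun i => ?_⟩
    rw [negVec, expMax_negTop]
    simpa [← expMax_negTop, toMin, toMax] using hl i

theorem negVec_mem_tropLowerClosure_maxHull (hC : IsAdditiveCone C) (hne : C.Nonempty)
    {v : Fin n → WithTop ℝ} :
    negVec v ∈ tropLowerClosure (maxHull (-C)) ↔ v ∈ tropUpperClosure (minHull C) :=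
  negVec_mem_tropLowerClosure_iff fun _ => neg_mem_maxHull_neg hC hne

theorem isDualTropicalGeneratingSet_iff (hC : IsAdditiveCone C) (hne : C.Nonempty)
    {V : Set (Fin n → WithTop ℝ)} :
    IsDualTropicalGeneratingSet V (tropUpperClosure (minHull C)) ↔
      IsTropicalGeneratingSet (negVec '' V) (tropLowerClosure (maxHull (-C))) := by
  refine and_congr ?_ ?_
  · rw [Set.image_subset_iff]
    exact forall₂_congr fun v _ => (negVec_mem_tropLowerClosure_maxHull hC hne).symm
  · rw [negVec_bijective.2.forall]
    refine forall_congr' fun v => imp_congr (negVec_mem_tropLowerClosure_maxHull hC hne).symm ?_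
    refine exists_congr fun m => ⟨?_, ?_⟩
    · rintro ⟨c, a, ha, rfl⟩
      refine ⟨fun k => negTop (c k), fun k => negVec (a k), fun k => ⟨_, ha k, rfl⟩, ?_⟩
      ext1 i
      simp only [negVec, negTop_finset_inf, negTop_add]
    · rintro ⟨c, a, ha, hv⟩
      choose b hbV hb using ha
      choose d hd using fun k => negTop_bijective.2 (c k)
      refine ⟨d, b, hbV, negVec_bijective.1 ?_⟩
      rw [hv]
      ext1 i
      simp only [negVec, negTop_finset_inf, negTop_add, hd, ← hb]

end Duality

/-! ### Finite generation as a coordinatewise condition -/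

section Selection

variable {n : ℕ} {C : Set (Fin n → ℝ)}

/-- Every finite coordinate of `y` is attained by a translate of an element of `U` lying
below `y`. -/
def IsSelected (U : Set (Fin n → WithBot ℝ)) (y : Fin n → WithBot ℝ) : Prop :=
  ∀ i, y i ≠ ⊥ → ∃ u ∈ U, u i ≠ ⊥ ∧ ∀ j, u j + y i ≤ y j + u i

/-- A finite supremum is attained at each coordinate, which forces the coefficient y i - u i of the
attaining generator. Conversely, one generator per coordinate suffices. -/
theorem exists_combination_iff_isSelected {U : Set (Fin n → WithBot ℝ)} {y : Fin n → WithBot ℝ} :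
    (∃ (m : ℕ) (c : Fin m → WithBot ℝ) (a : Fin m → Fin n → WithBot ℝ),
      (∀ k, a k ∈ U) ∧ y = fun i => Finset.univ.sup fun k => c k + a k i) ↔ IsSelected U y := by
  constructor
  · rintro ⟨m, c, a, ha, rfl⟩ i hi
    have hne : (Finset.univ : Finset (Fin m)).Nonempty := by
      by_contra h
      exact hi (by simp [Finset.not_nonempty_iff_eq_empty.1 h])
    obtain ⟨k, -, hk⟩ := Finset.exists_mem_eq_sup _ hne fun k => c k + a k i
    refine ⟨a k, ha k, fun h => hi (by simp [hk, h]), fun j => ?_⟩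
    have hj : c k + a k j ≤ Finset.univ.sup fun k => c k + a k j :=
      Finset.le_sup (f := fun k => c k + a k j) (Finset.mem_univ k)
    change _ + (Finset.univ.sup fun k => c k + a k i) ≤ _
    rw [hk, ← add_assoc, add_comm (a k j)]
    exact add_le_add_left hj _
  · intro h
    by_cases hy : ∀ i, y i = ⊥
    · exact ⟨0, Fin.elim0, Fin.elim0, fun k => k.elim0, by ext1 i; simp [hy]⟩
    · push Not at hy
      obtain ⟨i₀, hi₀⟩ := hy
      obtain ⟨u₀, hu₀, -⟩ := h i₀ hi₀
      have key : ∀ i, ∃ (c : WithBot ℝ) (u : Fin n → WithBot ℝ), u ∈ U ∧ c + u i = y i ∧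
          ∀ j, c + u j ≤ y j := fun i => by
        induction hyi : y i with
        -- An infinite coordinate needs no generator; any element of `U` with coefficient ⊥ fills
        -- the slot.
        | bot => exact ⟨⊥, u₀, hu₀, by simp, by simp⟩
        | coe r =>
          obtain ⟨u, hu, hui, hle⟩ := h i (by simp [hyi])
          lift u i to ℝ using hui with s hs
          refine ⟨((r - s : ℝ) : WithBot ℝ), u, hu, ?_, fun j => ?_⟩
          · rw [← hs, ← WithBot.coe_add, sub_add_cancel]
          · have := hle j
            rw [hyi] at this
            induction huj : u j with
            | bot => simp
            | coe t =>
              rw [huj] at this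
              induction hyj : y j with
              | bot => rw [hyj] at this; exact absurd this (by simp [← WithBot.coe_add])
              | coe q =>
                rw [hyj] at this
                have := WithBot.coe_le_coe.1 this
                exact WithBot.coe_le_coe.2 (by linarith)
      choose c a ha hai haj using key
      refine ⟨n, c, a, ha, funext fun i => le_antisymm ?_ ?_⟩
      · rw [← hai i]
        exact Finset.le_sup (f := fun k => c k + a k i) (Finset.mem_univ i)
      · exact Finset.sup_le fun k _ => haj k i

theorem isTropicalGeneratingSet_iff {U V : Set (Fin n → WithBot ℝ)} :
    IsTropicalGeneratingSet U V ↔ U ⊆ V ∧ ∀ v ∈ V, IsSelected U v :=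
  and_congr Iff.rfl (forall₂_congr fun _ _ => exists_combination_iff_isSelected)

/-- A finite family that touches every element of `C` from below at every coordinate selects
every element of the closure of the max-plus hull of `C`. -/
theorem isSelected_of_mem_tropLowerClosure {U : Set (Fin n → WithBot ℝ)} (hU : U.Finite)
    (hC : IsAdditiveCone C) (hne : C.Nonempty)
    (h : ∀ f ∈ C, ∀ i, ∃ u ∈ U, u i = 0 ∧ ∀ j, u j + (f i : WithBot ℝ) ≤ (f j : WithBot ℝ))
    {y : Fin n → WithBot ℝ} (hy : y ∈ tropLowerClosure (maxHull C)) : IsSelected U y := by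
  intro i _
  -- In exponential coordinates, touching at i is a closed condition that makes sense at -∞ too.
  -- Finiteness of `U` keeps the union closed, so it survives passage from C to the hull and to its
  -- limits.
  let A : Set (Fin n → ℝ) := ⋃ u ∈ {u ∈ U | u i = 0}, {z | ∀ j, expMax (u j) * z i ≤ z j}
  have hA : IsClosed A := by
    refine (hU.subset (Set.sep_subset _ _)).isClosed_biUnion fun u _ => ?_
    simp only [Set.ofPred_forall]
    exact isClosed_iInter fun j => isClosed_le (by fun_prop) (by fun_prop)
  have hmax : ∀ x ∈ maxHull C, (fun j => expMax (toMax x j)) ∈ A := fun x hx => by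
    -- Elements of C below x only reach x i up to ε, so x lowered at i is shown to lie in `A`, and ε
    -- tends to 0.
    have hlim : Tendsto (fun m : ℕ => Function.update (fun j => Real.exp (x j)) i
        (Real.exp (x i - 1 / ((m : ℝ) + 1)))) atTop (𝓝 fun j => Real.exp (x j)) := by
      have h1 : Tendsto (fun m : ℕ => Real.exp (x i - 1 / ((m : ℝ) + 1))) atTop
          (𝓝 (Real.exp (x i))) := by
        have := (tendsto_const_nhds (x := x i)).sub (tendsto_one_div_add_atTop_nhds_zero_nat (𝕜 := ℝ))
        rw [sub_zero] at this
        exact (Real.continuous_exp.tendsto _).comp this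
      have := (tendsto_const_nhds (x := fun j => Real.exp (x j))).update i h1
      rwa [Function.update_eq_self] at this
    refine hA.mem_of_tendsto hlim (Eventually.of_forall fun m => ?_)
    obtain ⟨f, hf, hfx, hfi⟩ := (mem_maxHull_iff hC hne).1 hx i (1 / ((m : ℝ) + 1)) (by positivity)
    obtain ⟨u, hu, hui, huj⟩ := h f hf i
    refine Set.mem_biUnion (x := u) ⟨hu, hui⟩ fun j => ?_
    rw [Function.update_self]
    rcases eq_or_ne j i with rfl | hji
    · rw [hui, Function.update_self]
      change Real.exp 0 * _ ≤ _
      simp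
    · rw [Function.update_of_ne hji]
      calc _ ≤ expMax (u j) * expMax (f i : WithBot ℝ) :=
            mul_le_mul_of_nonneg_left (Real.exp_le_exp.2 hfi) (expMax_nonneg _)
        _ = expMax (u j + (f i : WithBot ℝ)) := (expMax_add _ _).symm
        _ ≤ expMax (f j : WithBot ℝ) := expMax_le_expMax.2 (huj j)
        _ ≤ _ := Real.exp_le_exp.2 (hfx j)
  obtain ⟨x, hx, -, hlim⟩ := hy
  have := hA.mem_of_tendsto (tendsto_pi_nhds.2 hlim) (Eventually.of_forall fun k => hmax _ (hx k))
  obtain ⟨u, ⟨hu, hui⟩, hle⟩ := Set.mem_iUnion₂.1 this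
  refine ⟨u, hu, by simp [hui], fun j => ?_⟩
  rw [← expMax_le_expMax, expMax_add, hui, add_zero]
  exact hle j

/-- A real vector selected by limits of elements of the max-plus hull of `C` is approximated from
below by elements of `C`. -/
theorem exists_mem_le_of_isSelected (hC : IsAdditiveCone C) (hne : C.Nonempty)
    {U : Set (Fin n → WithBot ℝ)} (hU : U ⊆ tropLowerClosure (maxHull C)) {x : Fin n → ℝ}
    (hx : IsSelected U (toMax x)) (i : Fin n) {ε : ℝ} (hε : 0 < ε) :
    ∃ f ∈ C, (∀ j, f j ≤ x j + ε) ∧ x i - ε ≤ f i := by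
  obtain ⟨u, hu, hui, hle⟩ := hx i WithBot.coe_ne_bot
  obtain ⟨w, hw, hanti, hlim⟩ := hU hu
  lift u i to ℝ using hui with s hs
  -- The selection inequality for the limit u holds up to ε for late terms w k, at all the finitely
  -- many coordinates at once.
  have hev : ∀ j, ∀ᶠ k in atTop, w k j + x i ≤ x j + s + ε := fun j => by
    have h1 : expMax (u j) * Real.exp (x i) < Real.exp (x j + s + ε) := by
      refine lt_of_le_of_lt ?_ (Real.exp_lt_exp.2 (lt_add_of_pos_right (x j + s) hε))
      have := expMax_le_expMax.2 (hle j)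
      rwa [expMax_add, expMax_toMax] at this
    filter_upwards [((hlim j).mul_const (Real.exp (x i))).eventually_lt_const h1] with k hk
    rw [expMax_toMax, ← Real.exp_add, Real.exp_lt_exp] at hk
    exact hk.le
  obtain ⟨k, hk⟩ := (eventually_all.2 hev).exists
  -- A nonincreasing sequence stays above its limit.
  have hki : s ≤ w k i := by
    have hm : Antitone fun k => expMax (toMax (w k) i) := fun k l h => by
      simpa [expMax_toMax] using hanti h i
    have := hm.le_of_tendsto (hlim i) k
    rwa [← hs, expMax_toMax, expMax_coe, Real.exp_le_exp] at this
  obtain ⟨f, hf, hfw, hfi⟩ := (mem_maxHull_iff hC hne).1 (hw k) i ε hε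
  refine ⟨_, hC f hf (x i - s), fun j => ?_, ?_⟩
  · have := hk j
    have := hfw j
    linarith
  · linarith

/-- These joins are taken inside C and may exceed the pointwise maximum. -/
theorem exists_finset_join (hC : IsAmbitropicalCone C) {ι : Type*} {s : Finset ι}
    (hs : s.Nonempty) (f : ι → Fin n → ℝ) (hf : ∀ k ∈ s, f k ∈ C) :
    ∃ w ∈ C, (∀ k ∈ s, f k ≤ w) ∧ ∀ z ∈ C, (∀ k ∈ s, f k ≤ z) → w ≤ z := by
  induction hs using Finset.Nonempty.cons_induction with
  | singleton a => exact ⟨f a, hf a (by simp), by simp, fun z _ h => h a (by simp)⟩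
  | cons a s ha hs ih =>
    obtain ⟨w, hw, hub, hl⟩ := ih fun k hk => hf k (Finset.mem_cons_of_mem hk)
    obtain ⟨⟨v, hvub, hvl⟩, -⟩ := hC.2.2 ⟨f a, hf a (Finset.mem_cons_self _ _)⟩ ⟨w, hw⟩
    have hav : f a ≤ v := hvub (a := ⟨f a, hf a (Finset.mem_cons_self _ _)⟩) (by simp)
    have hwv : w ≤ v := hvub (a := ⟨w, hw⟩) (by simp)
    refine ⟨v, v.2, fun k hk => ?_, fun z hz h => ?_⟩
    · rcases Finset.mem_cons.1 hk with rfl | hk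
      · exact hav
      · exact (hub k hk).trans hwv
    · have hwz := hl z hz fun k hk => h k (Finset.mem_cons_of_mem hk)
      refine hvl (show (⟨z, hz⟩ : C) ∈ _ from ?_)
      rintro _ (rfl | rfl)
      · exact h a (Finset.mem_cons_self _ _)
      · exact hwz

/-- The join of the lower approximants belongs to C and lies below every slightly raised upper
approximant, which pins it near x at each coordinate. -/
theorem mem_of_approximations (hcl : IsClosed C) (hC : IsAmbitropicalCone C) {x : Fin n → ℝ}
    (hlow : ∀ i, ∀ ε > 0, ∃ f ∈ C, (∀ j, f j ≤ x j + ε) ∧ x i - ε ≤ f i)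
    (hup : ∀ i, ∀ ε > 0, ∃ f ∈ C, (∀ j, x j - ε ≤ f j) ∧ f i ≤ x i + ε) : x ∈ C := by
  rcases isEmpty_or_nonempty (Fin n) with _ | _
  · obtain ⟨y, hy⟩ := hC.1
    exact Subsingleton.elim y x ▸ hy
  rw [← hcl.closure_eq, Metric.mem_closure_iff]
  intro ε hε
  have hδ : 0 < ε / 4 := by positivity
  choose f hf hfx hfi using fun i => hlow i _ hδ
  choose g hg hgx hgi using fun i => hup i _ hδ
  obtain ⟨w, hw, hub, hl⟩ := exists_finset_join hC Finset.univ_nonempty f fun k _ => hf k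
  refine ⟨w, hw, (dist_pi_lt_iff hε).2 fun i => ?_⟩
  have h1 := hub i (Finset.mem_univ _) i
  -- One ε/4 lifts g i above x, the other absorbs the excess of the f k over x.
  have h2 := hl _ (hC.2.1 _ (hg i) (ε / 4 + ε / 4)) (fun k _ j => by
    have := hfx k j
    have := hgx i j
    simp only
    linarith) i
  have := hfi i
  have := hgi i
  rw [Real.dist_eq, abs_lt]
  constructor <;> linarith

end Selection

/-! ### Finite unions of alcoved polyhedra and finite descriptions -/

section AlcovedUnions

open scoped Pointwise

variable {n : ℕ} {C : Set (Fin n → ℝ)}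

theorem isAlcovedPolyhedron_of_imp (M : Matrix (Fin n) (Fin n) (WithBot ℝ)) :
    IsAlcovedPolyhedron {x : Fin n → ℝ | ∀ i j, ∀ r : ℝ, M i j = r → r + x j ≤ x i} := by
  refine ⟨M, Set.ext fun x => forall₂_congr fun i j => ?_⟩
  induction M i j with
  | bot => simp
  | coe s => simp [← WithBot.coe_add]

theorem IsAlcovedPolyhedron.exists_eq {P : Set (Fin n → ℝ)} (hP : IsAlcovedPolyhedron P) :
    ∃ M : Matrix (Fin n) (Fin n) (WithBot ℝ),
      P = {x : Fin n → ℝ | ∀ i j, ∀ r : ℝ, M i j = r → r + x j ≤ x i} := by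
  obtain ⟨M, rfl⟩ := hP
  refine ⟨M, Set.ext fun x => forall₂_congr fun i j => ?_⟩
  induction M i j with
  | bot => simp
  | coe s => simp [← WithBot.coe_add]

theorem IsAlcovedPolyhedron.inter {P Q : Set (Fin n → ℝ)} (hP : IsAlcovedPolyhedron P)
    (hQ : IsAlcovedPolyhedron Q) : IsAlcovedPolyhedron (P ∩ Q) := by
  obtain ⟨M, rfl⟩ := hP
  obtain ⟨N, rfl⟩ := hQ
  refine ⟨fun i j => M i j ⊔ N i j, Set.ext fun x => ?_⟩
  simp only [Set.mem_inter_iff, Set.mem_ofPred_eq, ← forall_and]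
  refine forall₂_congr fun i j => ?_
  rcases le_total (M i j) (N i j) with h | h
  · rw [sup_eq_right.2 h]
    exact ⟨fun h' => h'.2, fun h' => ⟨(add_le_add_left h _).trans h', h'⟩⟩
  · rw [sup_eq_left.2 h]
    exact ⟨fun h' => h'.1, fun h' => ⟨h', (add_le_add_left h _).trans h'⟩⟩

theorem IsAlcovedPolyhedron.neg {P : Set (Fin n → ℝ)} (hP : IsAlcovedPolyhedron P) :
    IsAlcovedPolyhedron (-P) := by
  obtain ⟨M, rfl⟩ := hP.exists_eq
  convert isAlcovedPolyhedron_of_imp M.transpose using 1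
  ext x
  rw [Set.mem_neg]
  refine forall_comm.trans (forall₂_congr fun i j => forall₂_congr fun r _ => ?_)
  simp only [Pi.neg_apply]
  constructor <;> intro h <;> linarith

theorem isAlcovedPolyhedron_setOf_le (i j : Fin n) (r : ℝ) :
    IsAlcovedPolyhedron {x : Fin n → ℝ | r + x j ≤ x i} := by
  classical
  convert isAlcovedPolyhedron_of_imp
    (fun k l => if k = i ∧ l = j then (r : WithBot ℝ) else ⊥) using 1
  ext x
  simp only [Set.mem_ofPred_eq]
  constructor
  · intro h k l s hs
    split_ifs at hs with hkl
    · rw [← WithBot.coe_inj.1 hs, hkl.1, hkl.2]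
      exact h
    · exact absurd hs WithBot.bot_ne_coe
  · intro h
    exact h i j r (by simp)

theorem IsAlcovedPolyhedron.isClosed {P : Set (Fin n → ℝ)} (hP : IsAlcovedPolyhedron P) :
    IsClosed P := by
  obtain ⟨M, rfl⟩ := hP.exists_eq
  simp only [Set.ofPred_forall]
  exact isClosed_iInter fun i => isClosed_iInter fun j => isClosed_iInter fun r =>
    isClosed_iInter fun _ => isClosed_le (by fun_prop) (by fun_prop)

/-- A finite union of alcoved polyhedra. -/
def IsAlcovedUnion (C : Set (Fin n → ℝ)) : Prop :=
  ∃ S : Set (Set (Fin n → ℝ)), S.Finite ∧ (∀ P ∈ S, IsAlcovedPolyhedron P) ∧ C = ⋃₀ S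

theorem IsAlcovedPolyhedron.isAlcovedUnion {P : Set (Fin n → ℝ)} (hP : IsAlcovedPolyhedron P) :
    IsAlcovedUnion P :=
  ⟨{P}, Set.finite_singleton P, by simpa using hP, by simp⟩

theorem IsAlcovedUnion.inter {A B : Set (Fin n → ℝ)} (hA : IsAlcovedUnion A)
    (hB : IsAlcovedUnion B) : IsAlcovedUnion (A ∩ B) := by
  obtain ⟨S, hSf, hS, rfl⟩ := hA
  obtain ⟨T, hTf, hT, rfl⟩ := hB
  refine ⟨Set.image2 (· ∩ ·) S T, hSf.image2 _ hTf, ?_, ?_⟩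
  · rintro _ ⟨P, hP, Q, hQ, rfl⟩
    exact (hS P hP).inter (hT Q hQ)
  · ext x
    simp only [Set.mem_inter_iff, Set.mem_sUnion, Set.mem_image2]
    constructor
    · rintro ⟨⟨P, hP, hxP⟩, Q, hQ, hxQ⟩
      exact ⟨_, ⟨P, hP, Q, hQ, rfl⟩, hxP, hxQ⟩
    · rintro ⟨_, ⟨P, hP, Q, hQ, rfl⟩, hxP, hxQ⟩
      exact ⟨⟨P, hP, hxP⟩, Q, hQ, hxQ⟩

theorem IsAlcovedUnion.neg (hC : IsAlcovedUnion C) : IsAlcovedUnion (-C) := by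
  obtain ⟨S, hSf, hS, rfl⟩ := hC
  refine ⟨(fun P => -P) '' S, hSf.image _, ?_, ?_⟩
  · rintro _ ⟨P, hP, rfl⟩
    exact (hS P hP).neg
  · ext x
    simp

theorem isAlcovedUnion_biUnion {ι : Type*} {s : Set ι} (hs : s.Finite)
    {A : ι → Set (Fin n → ℝ)} (hA : ∀ k ∈ s, IsAlcovedUnion (A k)) :
    IsAlcovedUnion (⋃ k ∈ s, A k) := by
  choose! S hSf hS hAS using hA
  refine ⟨⋃ k ∈ s, S k, hs.biUnion hSf, fun P hP => ?_, ?_⟩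
  · obtain ⟨k, hk, hPk⟩ := Set.mem_iUnion₂.1 hP
    exact hS k hk P hPk
  · ext x
    simp only [Set.mem_iUnion, Set.mem_sUnion]
    constructor
    · rintro ⟨k, hk, hx⟩
      rw [hAS k hk] at hx
      obtain ⟨P, hP, hxP⟩ := hx
      exact ⟨P, ⟨k, hk, hP⟩, hxP⟩
    · rintro ⟨P, ⟨k, hk, hP⟩, hxP⟩
      refine ⟨k, hk, ?_⟩
      rw [hAS k hk]
      exact ⟨P, hP, hxP⟩

theorem isAlcovedPolyhedron_univ : IsAlcovedPolyhedron (Set.univ : Set (Fin n → ℝ)) := by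
  convert isAlcovedPolyhedron_of_imp (fun _ _ => (⊥ : WithBot ℝ)) using 1
  ext x
  simp

theorem isAlcovedUnion_biInter {ι : Type*} (s : Finset ι)
    {A : ι → Set (Fin n → ℝ)} (hA : ∀ k ∈ s, IsAlcovedUnion (A k)) :
    IsAlcovedUnion (⋂ k ∈ s, A k) := by
  classical
  induction s using Finset.induction_on with
  | empty => simpa using isAlcovedPolyhedron_univ.isAlcovedUnion
  | insert a s ha ih =>
    rw [Finset.set_biInter_insert]
    exact (hA a (Finset.mem_insert_self _ _)).inter
      (ih fun k hk => hA k (Finset.mem_insert_of_mem hk))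

theorem isAlcovedUnion_iInter {ι : Type*} [Fintype ι] {A : ι → Set (Fin n → ℝ)}
    (hA : ∀ k, IsAlcovedUnion (A k)) : IsAlcovedUnion (⋂ k, A k) := by
  simpa using isAlcovedUnion_biInter Finset.univ fun k _ => hA k

theorem IsAlcovedUnion.isClosed (hC : IsAlcovedUnion C) : IsClosed C := by
  obtain ⟨S, hSf, hS, rfl⟩ := hC
  rw [Set.sUnion_eq_biUnion]
  exact hSf.isClosed_biUnion fun P hP => (hS P hP).isClosed

/-- Choosing a generator at each coordinate splits the condition into inequalities between x i and x
j, with constant u j - u i when u j is finite and no constraint otherwise. -/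
theorem isAlcovedUnion_setOf_isSelected {U : Set (Fin n → WithBot ℝ)} (hU : U.Finite) :
    IsAlcovedUnion {x : Fin n → ℝ | IsSelected U (toMax x)} := by
  have : {x : Fin n → ℝ | IsSelected U (toMax x)} = ⋂ i, ⋃ u ∈ {u ∈ U | u i ≠ ⊥},
      ⋂ j, {x | u j + toMax x i ≤ toMax x j + u i} := by
    ext x
    simp only [Set.mem_ofPred_eq, Set.mem_iInter, Set.mem_iUnion, IsSelected, exists_prop,
      and_assoc]
    exact forall_congr' fun i => ⟨fun h => h WithBot.coe_ne_bot, fun h _ => h⟩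
  rw [this]
  refine isAlcovedUnion_iInter fun i => isAlcovedUnion_biUnion (hU.subset (Set.sep_subset _ _))
    fun u hu => isAlcovedUnion_iInter fun j => IsAlcovedPolyhedron.isAlcovedUnion ?_
  have hui := hu.2
  lift u i to ℝ using hui with s
  induction u j with
  | bot => simpa using isAlcovedPolyhedron_univ
  | coe r =>
    convert isAlcovedPolyhedron_setOf_le j i (r - s) using 1
    ext x
    change ((r + x i : ℝ) : WithBot ℝ) ≤ ((x j + s : ℝ) : WithBot ℝ) ↔ r - s + x i ≤ x j
    rw [WithBot.coe_le_coe]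
    constructor <;> intro h <;> linarith

/-- The generator is the infimum of x - x j over P; alcoved polyhedra are stable under translations
and pointwise infima. -/
theorem IsAlcovedPolyhedron.exists_generator {P : Set (Fin n → ℝ)} (hP : IsAlcovedPolyhedron P)
    (hne : P.Nonempty) (j : Fin n) : ∃ g ∈ tropLowerClosure P, g j = 0 ∧
      ∀ x ∈ P, ∀ i, g i + (x j : WithBot ℝ) ≤ (x i : WithBot ℝ) := by
  obtain ⟨M, rfl⟩ := hP.exists_eq
  set P := {x : Fin n → ℝ | ∀ i j, ∀ r : ℝ, M i j = r → r + x j ≤ x i} with hPdef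
  obtain ⟨x₀, hx₀⟩ := hne
  have : Nonempty P := ⟨⟨x₀, hx₀⟩⟩
  -- The infimum may be -∞, so it is truncated from below by the translate x₀ - x₀ j - t of a point
  -- of P. The result is real, stays in P, and decreases to the generator.
  let v : ℕ → Fin n → P → ℝ := fun t i x => max (x.1 i - x.1 j) (x₀ i - x₀ j - t)
  let u : ℕ → Fin n → ℝ := fun t i => ⨅ x : P, v t i x
  have hbdd : ∀ t i, BddBelow (Set.range (v t i)) := fun t i =>
    ⟨x₀ i - x₀ j - t, by rintro _ ⟨x, rfl⟩; exact le_max_right _ _⟩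
  have huv : ∀ t i x, u t i ≤ v t i x := fun t i x => ciInf_le (hbdd t i) x
  have huP : ∀ t, u t ∈ P := fun t i k r hr => by
    refine le_ciInf fun x => ?_
    have h1 := x.2 i k r hr
    have h2 := hx₀ i k r hr
    have h3 := huv t k x
    refine (add_le_add_right h3 r).trans ?_
    simp only [v]
    rw [← max_add_add_left]
    exact max_le_max (by linarith) (by linarith)
  have hanti : Antitone u := fun s t hst i =>
    ciInf_mono (hbdd t i) fun x => max_le_max le_rfl (by
      have : (s : ℝ) ≤ t := by exact_mod_cast hst
      linarith)
  obtain ⟨g, hg⟩ := exists_tendsto_expMax hanti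
  refine ⟨g, ⟨u, huP, hanti, hg⟩, ?_, fun x hx i => ?_⟩
  · have huj : ∀ t, u t j = 0 := fun t => by
      have : ∀ x, v t j x = 0 := fun x => by simp [v]
      simp [u, this]
    have := tendsto_nhds_unique (hg j)
      (tendsto_const_nhds.congr fun t => by rw [expMax_toMax, huj t])
    exact le_antisymm (expMax_le_expMax.1 this.le) (expMax_le_expMax.1 this.ge)
  · rw [← expMax_le_expMax, expMax_add, expMax_coe, expMax_coe]
    refine le_of_tendsto ((hg i).mul_const _) ?_
    -- Beyond this index the truncation is inactive for x at i.
    obtain ⟨N, hN⟩ := exists_nat_ge (x₀ i - x₀ j - (x i - x j))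
    filter_upwards [eventually_ge_atTop N] with t ht
    have h1 := huv t i ⟨x, hx⟩
    have h2 : (N : ℝ) ≤ t := by exact_mod_cast ht
    have h3 : v t i ⟨x, hx⟩ = x i - x j := max_eq_left (by linarith)
    rw [expMax_toMax, ← Real.exp_add, Real.exp_le_exp]
    linarith

theorem IsAlcovedUnion.exists_generators (hC : IsAlcovedUnion C) :
    ∃ U : Set (Fin n → WithBot ℝ), U.Finite ∧ U ⊆ tropLowerClosure C ∧ (∀ u ∈ U, u ≠ ⊥) ∧
      ∀ f ∈ C, ∀ i, ∃ u ∈ U, u i = 0 ∧ ∀ j, u j + (f i : WithBot ℝ) ≤ (f j : WithBot ℝ) := by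
  obtain ⟨S, hSf, hS, rfl⟩ := hC
  choose! g hg hg0 hgle using fun (P : Set (Fin n → ℝ)) (j : Fin n)
    (h : IsAlcovedPolyhedron P ∧ P.Nonempty) => h.1.exists_generator h.2 j
  refine ⟨Set.image2 g {P ∈ S | P.Nonempty} Set.univ,
    (hSf.subset (Set.sep_subset _ _)).image2 _ Set.finite_univ, ?_, ?_, ?_⟩
  · rintro _ ⟨P, ⟨hP, hne⟩, j, -, rfl⟩
    exact tropLowerClosure_mono (Set.subset_sUnion_of_mem hP) (hg P j ⟨hS P hP, hne⟩)
  · rintro _ ⟨P, ⟨hP, hne⟩, j, -, rfl⟩ h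
    have := hg0 P j ⟨hS P hP, hne⟩
    rw [h] at this
    exact absurd this WithBot.bot_ne_zero
  · rintro f ⟨P, hP, hf⟩ i
    have hPP : IsAlcovedPolyhedron P ∧ P.Nonempty := ⟨hS P hP, f, hf⟩
    exact ⟨g P i, ⟨P, ⟨hP, f, hf⟩, i, trivial, rfl⟩, hg0 P i hPP, hgle P i hPP f hf⟩

theorem IsAlcovedUnion.exists_tropicalGeneratingSet (hC : IsAlcovedUnion C)
    (hcone : IsAdditiveCone C) (hne : C.Nonempty) :
    ∃ U : Set (Fin n → WithBot ℝ), U.Finite ∧ (∀ u ∈ U, u ≠ ⊥) ∧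
      IsTropicalGeneratingSet U (tropLowerClosure (maxHull C)) := by
  obtain ⟨U, hUf, hU, hbot, h⟩ := hC.exists_generators
  exact ⟨U, hUf, hbot, isTropicalGeneratingSet_iff.2
    ⟨hU.trans (tropLowerClosure_mono (subset_maxHull hcone)),
      fun y hy => isSelected_of_mem_tropLowerClosure hUf hcone hne h hy⟩⟩

theorem isAlcovedUnion_of_isFiniteDescription (hcl : IsClosed C) (hC : IsAmbitropicalCone C)
    {U : Set (Fin n → WithBot ℝ)} {V : Set (Fin n → WithTop ℝ)} (h : IsFiniteDescription C U V) :
    IsAlcovedUnion C := by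
  obtain ⟨⟨hU, hV⟩, hUf, hVf⟩ := h
  have hcone := hC.2.1
  rw [isDualTropicalGeneratingSet_iff hcone hC.1, isTropicalGeneratingSet_iff] at hV
  rw [isTropicalGeneratingSet_iff] at hU
  -- The two selection conditions give lower and upper approximants in C, so `mem_of_approximations`
  -- yields the nontrivial inclusion.
  have hCeq : C = {x | IsSelected U (toMax x)} ∩ -{x | IsSelected (negVec '' V) (toMax x)} := by
    refine Set.Subset.antisymm (fun x hx => ⟨?_, ?_⟩) ?_
    · exact hU.2 _ (toMax_mem_tropLowerClosure (subset_maxHull hcone hx))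
    · exact hV.2 _ (toMax_mem_tropLowerClosure (subset_maxHull hcone.neg (by simpa using hx)))
    · rintro x ⟨h1, h2⟩
      refine mem_of_approximations hcl hC
        (fun i ε hε => exists_mem_le_of_isSelected hcone hC.1 hU.1 h1 i hε) fun i ε hε => ?_
      obtain ⟨f, hf, hfx, hfi⟩ := exists_mem_le_of_isSelected hcone.neg hC.1.neg hV.1 h2 i hε
      refine ⟨-f, hf, fun j => ?_, ?_⟩
      · have := hfx j
        simp only [Pi.neg_apply] at this ⊢
        linarith
      · simp only [Pi.neg_apply] at hfi ⊢
        linarith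
  rw [hCeq]
  exact (isAlcovedUnion_setOf_isSelected hUf).inter
    (isAlcovedUnion_setOf_isSelected (hVf.image _)).neg

theorem IsAlcovedUnion.exists_isFiniteDescription (hC : IsAlcovedUnion C)
    (hcone : IsAdditiveCone C) (hne : C.Nonempty) :
    ∃ (U : Set (Fin n → WithBot ℝ)) (V : Set (Fin n → WithTop ℝ)),
      IsFiniteDescription C U V ∧ (∀ u ∈ U, u ≠ ⊥) ∧ ∀ v ∈ V, v ≠ ⊤ := by
  obtain ⟨U, hUf, hUb, hU⟩ := hC.exists_tropicalGeneratingSet hcone hne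
  obtain ⟨V, hVf, hVb, hV⟩ := hC.neg.exists_tropicalGeneratingSet hcone.neg hne.neg
  refine ⟨U, negVec ⁻¹' V, ⟨⟨hU, ?_⟩, hUf, hVf.preimage negVec_bijective.1.injOn⟩, hUb, ?_⟩
  · rw [isDualTropicalGeneratingSet_iff hcone hne,
      Set.image_preimage_eq _ negVec_bijective.2]
    exact hV
  · intro v hv h
    exact hVb _ hv (negVec_eq_bot.2 h)

end AlcovedUnions

/-! ### Hilbert boundedness and real generators -/

section Boundedness

open scoped Pointwise

variable {n : ℕ} {C : Set (Fin n → ℝ)}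

theorem sub_le_hilbertSeminorm (x : Fin n → ℝ) (i j : Fin n) : x i - x j ≤ hilbertSeminorm x :=
  sub_le_sub (le_ciSup (Set.finite_range x).bddAbove i) (ciInf_le (Set.finite_range x).bddBelow j)

theorem hilbertSeminorm_le {x : Fin n → ℝ} {R : ℝ} (hR : 0 ≤ R) (h : ∀ i j, x i - x j ≤ R) :
    hilbertSeminorm x ≤ R := by
  rcases isEmpty_or_nonempty (Fin n) with _ | _
  · simpa [hilbertSeminorm] using hR
  · obtain ⟨i, hi⟩ := exists_eq_ciSup_of_finite (f := x)
    obtain ⟨j, hj⟩ := exists_eq_ciInf_of_finite (f := x)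
    rw [hilbertSeminorm, ← hi, ← hj]
    exact h i j

/-- Bounds on coordinate differences pass to suprema and to limits, where a single finite coordinate
then forces all of them to be finite. -/
theorem mem_range_toMax_of_bounded (hC : IsAdditiveCone C) (hne : C.Nonempty) {R : ℝ}
    (hR : ∀ x ∈ C, ∀ i j, x i - x j ≤ R) {y : Fin n → WithBot ℝ}
    (hy : y ∈ tropLowerClosure (maxHull C)) (hbot : y ≠ ⊥) : y ∈ Set.range toMax := by
  obtain ⟨u, hu, -, hlim⟩ := hy
  have hle : ∀ k i j, u k i ≤ R + u k j := fun k i j => le_of_forall_pos_le_add fun ε hε => by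
    obtain ⟨f, hf, hfu, hfi⟩ := (mem_maxHull_iff hC hne).1 (hu k) i ε hε
    have := hR f hf i j
    have := hfu j
    linarith
  have hlim' : ∀ i j, expMax (y i) ≤ Real.exp R * expMax (y j) := fun i j =>
    le_of_tendsto_of_tendsto' (hlim i) ((hlim j).const_mul _) fun k => by
      rw [expMax_toMax, expMax_toMax, ← Real.exp_add, Real.exp_le_exp]
      exact hle k i j
  obtain ⟨i, hi⟩ := Function.ne_iff.1 hbot
  have hreal : ∀ j, ∃ r : ℝ, (r : WithBot ℝ) = y j := fun j => by
    refine WithBot.ne_bot_iff_exists.1 fun hj => ?_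
    have := hlim' i j
    rw [hj, expMax_bot, mul_zero] at this
    exact absurd this (expMax_pos hi).not_ge
  choose x hx using hreal
  exact ⟨x, funext hx⟩

theorem exists_hilbertSeminorm_le (hC : IsAdditiveCone C) {U : Set (Fin n → WithBot ℝ)}
    (hUf : U.Finite) (hU : IsTropicalGeneratingSet U (tropLowerClosure (maxHull C)))
    (hreal : ∀ u ∈ U, u ≠ ⊥ → u ∈ Set.range toMax) :
    ∃ R : ℝ, ∀ x ∈ C, hilbertSeminorm x ≤ R := by
  -- The default value 0 is harmless: the bound is only applied to real generators.
  obtain ⟨R, hR⟩ := (hUf.image fun u => hilbertSeminorm fun i => (u i).unbotD 0).bddAbove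
  refine ⟨max R 0, fun x hx => hilbertSeminorm_le (le_max_right _ _) fun i j => ?_⟩
  obtain ⟨u, hu, hui, hle⟩ := (isTropicalGeneratingSet_iff.1 hU).2 _
    (toMax_mem_tropLowerClosure (subset_maxHull hC hx)) i WithBot.coe_ne_bot
  obtain ⟨w, rfl⟩ := hreal u hu fun h => hui (by simp [h])
  have h1 : w j + x i ≤ x j + w i := WithBot.coe_le_coe.1 (hle j)
  have h2 : hilbertSeminorm w ≤ R := hR ⟨_, hu, rfl⟩
  have h3 := sub_le_hilbertSeminorm w i j
  have := le_max_left R 0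
  linarith

theorem isAmbitropicalPolyhedron_iff_exists_isFiniteDescription (hcl : IsClosed C)
    (hC : IsAmbitropicalCone C) :
    IsAmbitropicalPolyhedron C ↔ ∃ (U : Set (Fin n → WithBot ℝ)) (V : Set (Fin n → WithTop ℝ)),
      IsFiniteDescription C U V := by
  constructor
  · rintro ⟨-, h⟩
    obtain ⟨U, V, hUV, -⟩ := IsAlcovedUnion.exists_isFiniteDescription h hC.2.1 hC.1
    exact ⟨U, V, hUV⟩
  · rintro ⟨U, V, h⟩
    exact ⟨hC, isAlcovedUnion_of_isFiniteDescription hcl hC h⟩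

theorem IsFiniteDescription.isAmbitropicalPolytope_iff (hcl : IsClosed C)
    (hC : IsAmbitropicalCone C) {U : Set (Fin n → WithBot ℝ)} {V : Set (Fin n → WithTop ℝ)}
    (h : IsFiniteDescription C U V) :
    IsAmbitropicalPolytope C ↔ (∀ u ∈ U, u ≠ ⊥ → u ∈ Set.range toMax) ∧
      ∀ v ∈ V, v ≠ ⊤ → v ∈ Set.range toMin := by
  constructor
  · rintro ⟨-, R, hR⟩
    have hR' : ∀ x ∈ C, ∀ i j, x i - x j ≤ R := fun x hx i j =>
      (sub_le_hilbertSeminorm x i j).trans (hR x hx)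
    refine ⟨fun u hu => mem_range_toMax_of_bounded hC.2.1 hC.1 hR' (h.1.1.1 hu),
      fun v hv hvt => ?_⟩
    refine negVec_mem_range_toMax.1 (mem_range_toMax_of_bounded (R := R) hC.2.1.neg hC.1.neg
      (fun x hx i j => ?_) ((negVec_mem_tropLowerClosure_maxHull hC.2.1 hC.1).2 (h.1.2.1 hv))
      fun hb => hvt (negVec_eq_bot.1 hb))
    have := hR' _ hx j i
    simp only [Pi.neg_apply] at this
    linarith
  · rintro ⟨hU, -⟩
    exact ⟨⟨hC, isAlcovedUnion_of_isFiniteDescription hcl hC h⟩,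
      exists_hilbertSeminorm_le hC.2.1 h.2.1 h.1.1 hU⟩

/-- Generators built from alcoved pieces avoid ⊥ and ⊤, the only non-real ones that the criterion
tolerates. -/
theorem isAmbitropicalPolytope_iff_exists_isFiniteDescription (hcl : IsClosed C)
    (hC : IsAmbitropicalCone C) :
    IsAmbitropicalPolytope C ↔ ∃ (U : Set (Fin n → WithBot ℝ)) (V : Set (Fin n → WithTop ℝ)),
      IsFiniteDescription C U V ∧ U ⊆ Set.range toMax ∧ V ⊆ Set.range toMin := by
  constructor
  · intro h
    obtain ⟨U, V, hUV, hU, hV⟩ :=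
      IsAlcovedUnion.exists_isFiniteDescription h.1.2 hC.2.1 hC.1
    have h' := (hUV.isAmbitropicalPolytope_iff hcl hC).1 h
    exact ⟨U, V, hUV, fun u hu => h'.1 u hu (hU u hu), fun v hv => h'.2 v hv (hV v hv)⟩
  · rintro ⟨U, V, hUV, hU, hV⟩
    exact (hUV.isAmbitropicalPolytope_iff hcl hC).2 ⟨fun u hu _ => hU hu, fun v hv _ => hV hv⟩

end Boundedness

/-! ### Min-max functions -/

section MinMax

variable {n : ℕ}

/-- Functions whose comparisons with translated coordinates define finite unions of alcoved
polyhedra. -/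
def IsMinMax (φ : (Fin n → ℝ) → ℝ) : Prop :=
  ∀ (j : Fin n) (r : ℝ), IsAlcovedUnion {x | φ x ≤ r + x j} ∧ IsAlcovedUnion {x | r + x j ≤ φ x}

theorem isMinMax_apply (i : Fin n) : IsMinMax fun x : Fin n → ℝ => x i := fun j r => by
  refine ⟨?_, (isAlcovedPolyhedron_setOf_le i j r).isAlcovedUnion⟩
  convert (isAlcovedPolyhedron_setOf_le j i (-r)).isAlcovedUnion using 1
  ext x
  change x i ≤ r + x j ↔ -r + x i ≤ x j
  exact neg_add_le_iff_le_add.symm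

theorem IsMinMax.add_const {φ : (Fin n → ℝ) → ℝ} (hφ : IsMinMax φ) (c : ℝ) :
    IsMinMax fun x => φ x + c := fun j r => by
  obtain ⟨h1, h2⟩ := hφ j (r - c)
  constructor
  · convert h1 using 1
    ext x
    change φ x + c ≤ r + x j ↔ φ x ≤ r - c + x j
    constructor <;> intro h <;> linarith
  · convert h2 using 1
    ext x
    change r + x j ≤ φ x + c ↔ r - c + x j ≤ φ x
    constructor <;> intro h <;> linarith

/-- Bounding a maximum from above is an intersection of conditions, bounding it from below is a
union. -/
theorem IsMinMax.finset_sup' {κ : Type*} {t : Finset κ} (ht : t.Nonempty)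
    {φ : κ → (Fin n → ℝ) → ℝ} (hφ : ∀ k, IsMinMax (φ k)) :
    IsMinMax fun x => t.sup' ht fun k => φ k x := fun j r => by
  constructor
  · convert isAlcovedUnion_biInter t fun k _ => (hφ k j r).1 using 1
    ext x
    simp
  · convert isAlcovedUnion_biUnion t.finite_toSet fun k _ => (hφ k j r).2 using 1
    ext x
    simp

theorem IsMinMax.finset_inf' {κ : Type*} {t : Finset κ} (ht : t.Nonempty)
    {φ : κ → (Fin n → ℝ) → ℝ} (hφ : ∀ k, IsMinMax (φ k)) :
    IsMinMax fun x => t.inf' ht fun k => φ k x := fun j r => by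
  constructor
  · convert isAlcovedUnion_biUnion t.finite_toSet fun k _ => (hφ k j r).1 using 1
    ext x
    simp
  · convert isAlcovedUnion_biInter t fun k _ => (hφ k j r).2 using 1
    ext x
    simp

end MinMax

/-! ### Tropical projections and the retraction onto a hull -/

section Projections

variable {n : ℕ} [Nonempty (Fin n)] {ι : Type*} {s : Finset ι} (hs : s.Nonempty)
  (e : ι → Fin n → ℝ)

/-- The greatest `c` such that `c + f ≤ x`. -/
def lowerGap (f x : Fin n → ℝ) : ℝ := Finset.univ.inf' Finset.univ_nonempty fun j => x j - f j

/-- The least `c` such that `x ≤ c + f`. -/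
def upperGap (f x : Fin n → ℝ) : ℝ := Finset.univ.sup' Finset.univ_nonempty fun j => x j - f j

theorem le_lowerGap_iff {f x : Fin n → ℝ} {c : ℝ} : c ≤ lowerGap f x ↔ ∀ j, c + f j ≤ x j := by
  simp [lowerGap, le_sub_iff_add_le]

theorem upperGap_le_iff {f x : Fin n → ℝ} {c : ℝ} : upperGap f x ≤ c ↔ ∀ j, x j ≤ c + f j := by
  simp [upperGap]

theorem lowerGap_add_le (f x : Fin n → ℝ) (j : Fin n) : lowerGap f x + f j ≤ x j :=
  le_lowerGap_iff.1 le_rfl j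

theorem le_upperGap_add (f x : Fin n → ℝ) (j : Fin n) : x j ≤ upperGap f x + f j :=
  upperGap_le_iff.1 le_rfl j

/-- The max-plus projection onto the max-plus span of the vectors `e k`, `k ∈ s`. -/
def maxProj (x : Fin n → ℝ) : Fin n → ℝ := fun i => s.sup' hs fun k => lowerGap (e k) x + e k i

/-- The min-plus projection onto the min-plus span of the vectors `e k`, `k ∈ s`. -/
def minProj (x : Fin n → ℝ) : Fin n → ℝ := fun i => s.inf' hs fun k => upperGap (e k) x + e k i

variable {e}

theorem maxProj_le_iff {x z : Fin n → ℝ} :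
    maxProj hs e x ≤ z ↔ ∀ k ∈ s, (fun i => lowerGap (e k) x + e k i) ≤ z := by
  simp only [Pi.le_def, maxProj, Finset.sup'_le_iff]
  exact ⟨fun h k hk i => h i k hk, fun h i k hk => h k hk i⟩

theorem le_minProj_iff {x z : Fin n → ℝ} :
    z ≤ minProj hs e x ↔ ∀ k ∈ s, z ≤ (fun i => upperGap (e k) x + e k i) := by
  simp only [Pi.le_def, minProj, Finset.le_inf'_iff]
  exact ⟨fun h k hk i => h i k hk, fun h i k hk => h k hk i⟩

theorem maxProj_le (x : Fin n → ℝ) : maxProj hs e x ≤ x :=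
  (maxProj_le_iff hs).2 fun k _ => lowerGap_add_le (e k) x

theorem le_minProj (x : Fin n → ℝ) : x ≤ minProj hs e x :=
  (le_minProj_iff hs).2 fun k _ => le_upperGap_add (e k) x

theorem add_le_maxProj {x : Fin n → ℝ} {k : ι} (hk : k ∈ s) {c : ℝ}
    (h : (fun i => c + e k i) ≤ x) : (fun i => c + e k i) ≤ maxProj hs e x := fun i =>
  (add_le_add_left (le_lowerGap_iff.2 h) _).trans ((maxProj_le_iff hs).1 le_rfl k hk i)

theorem minProj_le_add {x : Fin n → ℝ} {k : ι} (hk : k ∈ s) {c : ℝ}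
    (h : x ≤ fun i => c + e k i) : minProj hs e x ≤ fun i => c + e k i := fun i =>
  ((le_minProj_iff hs).1 le_rfl k hk i).trans (add_le_add_left (upperGap_le_iff.2 h) _)

theorem maxProj_mono : Monotone (maxProj hs e) := fun x _ h =>
  (maxProj_le_iff hs).2 fun k hk => add_le_maxProj hs hk fun i =>
    (lowerGap_add_le (e k) x i).trans (h i)

theorem minProj_mono : Monotone (minProj hs e) := fun _ y h =>
  (le_minProj_iff hs).2 fun k hk => minProj_le_add hs hk fun i =>
    (h i).trans (le_upperGap_add (e k) y i)

theorem maxProj_maxProj (x : Fin n → ℝ) : maxProj hs e (maxProj hs e x) = maxProj hs e x :=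
  le_antisymm (maxProj_le hs _) <| (maxProj_le_iff hs).2 fun k hk =>
    add_le_maxProj hs hk ((maxProj_le_iff hs).1 le_rfl k hk)

theorem minProj_minProj (x : Fin n → ℝ) : minProj hs e (minProj hs e x) = minProj hs e x :=
  le_antisymm ((le_minProj_iff hs).2 fun k hk =>
    minProj_le_add hs hk ((le_minProj_iff hs).1 le_rfl k hk)) (le_minProj hs _)

theorem lowerGap_add (f x : Fin n → ℝ) (r : ℝ) :
    lowerGap f (fun i => r + x i) = r + lowerGap f x := by
  refine eq_of_forall_le_iff fun c => ?_
  rw [← sub_le_iff_le_add', le_lowerGap_iff, le_lowerGap_iff]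
  exact forall_congr' fun j => by constructor <;> intro h <;> linarith

theorem upperGap_add (f x : Fin n → ℝ) (r : ℝ) :
    upperGap f (fun i => r + x i) = r + upperGap f x := by
  refine eq_of_forall_ge_iff fun c => ?_
  rw [← le_sub_iff_add_le', upperGap_le_iff, upperGap_le_iff]
  exact forall_congr' fun j => by constructor <;> intro h <;> linarith

theorem maxProj_add (x : Fin n → ℝ) (r : ℝ) :
    maxProj hs e (fun i => r + x i) = fun i => r + maxProj hs e x i := by
  ext i
  simp only [maxProj, lowerGap_add, Finset.add_sup', add_assoc]

theorem minProj_add (x : Fin n → ℝ) (r : ℝ) :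
    minProj hs e (fun i => r + x i) = fun i => r + minProj hs e x i := by
  ext i
  simp only [minProj, upperGap_add, add_assoc]
  exact (Finset.apply_inf'_eq_inf'_comp hs (r + ·) fun a b => (min_add_add_left r a b).symm).symm

/-- The retraction `minProj ∘ maxProj`. -/
def hullRetraction (e : ι → Fin n → ℝ) (x : Fin n → ℝ) : Fin n → ℝ :=
  minProj hs e (maxProj hs e x)

theorem hullRetraction_mono : Monotone (hullRetraction hs e) :=
  (minProj_mono hs).comp (maxProj_mono hs)

theorem hullRetraction_idem (x : Fin n → ℝ) :
    hullRetraction hs e (hullRetraction hs e x) = hullRetraction hs e x := by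
  refine le_antisymm ?_ (minProj_mono hs ?_)
  · refine (minProj_mono hs (maxProj_le hs _)).trans ?_
    exact (minProj_minProj hs _).le
  · refine (maxProj_maxProj hs x).ge.trans (maxProj_mono hs (le_minProj hs _))

variable (e) in
/-- The fixed points of the retraction `hullRetraction`. -/
def retractHull : Set (Fin n → ℝ) := {x | hullRetraction hs e x = x}

theorem mem_retractHull {k : ι} (hk : k ∈ s) : e k ∈ retractHull hs e := by
  have h1 : maxProj hs e (e k) = e k := le_antisymm (maxProj_le hs _) fun i => by
    simpa using add_le_maxProj hs hk (x := e k) (c := 0) (by simp) i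
  have h2 : minProj hs e (e k) = e k := le_antisymm (fun i => by
    simpa using minProj_le_add hs hk (x := e k) (c := 0) (by simp) i) (le_minProj hs _)
  exact (congrArg _ h1).trans h2

/-- The image of a monotone idempotent map is a lattice: retract the pointwise supremum or infimum.
-/
theorem isAmbitropicalCone_retractHull : IsAmbitropicalCone (retractHull hs e) := by
  refine ⟨⟨_, mem_retractHull hs hs.choose_spec⟩, fun x hx r => ?_, fun x y => ⟨?_, ?_⟩⟩
  · have : hullRetraction hs e x = x := hx
    change hullRetraction hs e _ = _
    rw [hullRetraction, maxProj_add, minProj_add]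
    exact congrArg (fun z : Fin n → ℝ => fun i => r + z i) this
  · refine ⟨⟨hullRetraction hs e (x.1 ⊔ y.1), hullRetraction_idem hs _⟩, ?_, ?_⟩
    · rintro z (rfl | rfl)
      · exact (show hullRetraction hs e z.1 = z.1 from z.2).ge.trans
          (hullRetraction_mono hs le_sup_left)
      · exact (show hullRetraction hs e z.1 = z.1 from z.2).ge.trans
          (hullRetraction_mono hs le_sup_right)
    · intro z hz
      have h1 : x.1 ⊔ y.1 ≤ z.1 := sup_le (hz (Set.mem_insert _ _)) (hz (by simp))
      exact (hullRetraction_mono hs h1).trans (show hullRetraction hs e z.1 = z.1 from z.2).le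
  · refine ⟨⟨hullRetraction hs e (x.1 ⊓ y.1), hullRetraction_idem hs _⟩, ?_, ?_⟩
    · rintro z (rfl | rfl)
      · exact (hullRetraction_mono hs inf_le_left).trans
          (show hullRetraction hs e z.1 = z.1 from z.2).le
      · exact (hullRetraction_mono hs inf_le_right).trans
          (show hullRetraction hs e z.1 = z.1 from z.2).le
    · intro z hz
      have h1 : z.1 ≤ x.1 ⊓ y.1 := le_inf (hz (Set.mem_insert _ _)) (hz (by simp))
      exact (show hullRetraction hs e z.1 = z.1 from z.2).ge.trans (hullRetraction_mono hs h1)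

/-- For a fixed point x, the join w in F of the translated generators below x equals x. It lies
under the translates whose infimum is x, and it dominates the max-plus projection of x while being
itself a fixed point. -/
theorem retractHull_subset {F : Set (Fin n → ℝ)} (hF : IsAmbitropicalCone F)
    (he : ∀ k ∈ s, e k ∈ F) (hFH : F ⊆ retractHull hs e) : retractHull hs e ⊆ F := by
  intro x hx
  have hx' : hullRetraction hs e x = x := hx
  obtain ⟨w, hw, hub, hl⟩ := exists_finset_join hF hs
    (fun k i => lowerGap (e k) x + e k i) fun k hk => hF.2.1 _ (he k hk) _
  have h1 : maxProj hs e x ≤ w := (maxProj_le_iff hs).2 hub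
  have h2 : w ≤ x := by
    rw [← hx']
    refine (le_minProj_iff hs).2 fun k hk => hl _ (hF.2.1 _ (he k hk) _) fun l hl' => ?_
    exact ((maxProj_le_iff hs).1 le_rfl l hl').trans (le_upperGap_add _ _)
  have h3 : x ≤ w := by
    have hw' : hullRetraction hs e w = w := hFH hw
    rw [← hx', ← hw']
    refine minProj_mono hs ?_
    rw [← maxProj_maxProj]
    exact maxProj_mono hs h1
  exact le_antisymm h2 h3 ▸ hw

theorem isMinMax_hullRetraction (i : Fin n) : IsMinMax fun x => hullRetraction hs e x i := by
  have hmax : ∀ j, IsMinMax fun x => maxProj hs e x j := fun j =>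
    .finset_sup' hs fun k => .add_const (.finset_inf' _ fun l => by
      simpa only [sub_eq_add_neg] using (isMinMax_apply l).add_const (-e k l)) _
  exact .finset_inf' hs fun k => .add_const (.finset_sup' _ fun l => by
    simpa only [sub_eq_add_neg] using (hmax l).add_const (-e k l)) _

theorem isAlcovedUnion_retractHull : IsAlcovedUnion (retractHull hs e) := by
  have : retractHull hs e = ⋂ i, ({x | hullRetraction hs e x i ≤ 0 + x i} ∩
      {x | 0 + x i ≤ hullRetraction hs e x i}) := by
    ext x
    simp only [Set.mem_iInter, Set.mem_inter_iff, Set.mem_ofPred_eq, zero_add, ← le_antisymm_iff]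
    exact funext_iff
  rw [this]
  exact isAlcovedUnion_iInter fun i =>
    (isMinMax_hullRetraction hs i i 0).1.inter (isMinMax_hullRetraction hs i i 0).2

theorem isAmbitropicalPolytope_retractHull : IsAmbitropicalPolytope (retractHull hs e) := by
  refine ⟨⟨isAmbitropicalCone_retractHull hs, isAlcovedUnion_retractHull hs⟩, ?_⟩
  obtain ⟨R, hR⟩ := (s.finite_toSet.image fun k => hilbertSeminorm (e k)).bddAbove
  refine ⟨max R 0, fun x hx => hilbertSeminorm_le (le_max_right _ _) fun i j => ?_⟩
  have hx' : hullRetraction hs e x = x := hx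
  -- For the generator k attaining the infimum at j, x i - x j is at most e k i - e k j.
  obtain ⟨k, hk, hkj⟩ := s.exists_mem_eq_inf' hs
    fun k => upperGap (e k) (maxProj hs e x) + e k j
  have h1 : x j = upperGap (e k) (maxProj hs e x) + e k j := (congrFun hx' j).symm.trans hkj
  have h2 : x i ≤ upperGap (e k) (maxProj hs e x) + e k i :=
    (congrFun hx' i).ge.trans ((le_minProj_iff hs).1 le_rfl k hk i)
  have h3 : hilbertSeminorm (e k) ≤ R := hR ⟨k, hk, rfl⟩
  have h4 := sub_le_hilbertSeminorm (e k) i j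
  have := le_max_left R 0
  linarith

end Projections

/-! ### Polytopes as hulls of finite sets -/

section PolytopeHulls

open scoped Pointwise

variable {n : ℕ}

theorem isAmbitropicalHull_retractHull [Nonempty (Fin n)] {s : Finset (Fin n → ℝ)}
    (hs : s.Nonempty) : IsAmbitropicalHull (s : Set (Fin n → ℝ)) (retractHull hs id) :=
  ⟨⟨(isAlcovedUnion_retractHull hs).isClosed, isAmbitropicalCone_retractHull hs,
    fun _ hx => mem_retractHull hs hx⟩, fun _ hF hFH => retractHull_subset hs hF.2.1 hF.2.2 hFH⟩

/-- The hull is the line of constant vectors: a nonempty cone inside it contains a translate of 0,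
hence 0. -/
theorem exists_isAmbitropicalHull_empty [Nonempty (Fin n)] :
    ∃ H : Set (Fin n → ℝ), IsAmbitropicalHull ∅ H ∧ IsAmbitropicalPolytope H := by
  have hs : ({0} : Finset (Fin n → ℝ)).Nonempty := Finset.singleton_nonempty 0
  refine ⟨retractHull hs id, ⟨⟨(isAlcovedUnion_retractHull hs).isClosed,
    isAmbitropicalCone_retractHull hs, Set.empty_subset _⟩, fun F hF hFH => ?_⟩,
    isAmbitropicalPolytope_retractHull hs⟩
  obtain ⟨f, hf⟩ := hF.2.1.1
  have h0 : (0 : Fin n → ℝ) ∈ F := by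
    have h1 : hullRetraction hs id f = f := hFH hf
    have h2 : ∀ i, upperGap 0 (maxProj hs id f) = f i := fun i => by
      simpa [hullRetraction, minProj] using congrFun h1 i
    convert hF.2.1.2.1 f hf (-upperGap 0 (maxProj hs id f)) using 1
    ext i
    rw [h2 i]
    simp
  exact retractHull_subset hs hF.2.1 (by simpa using h0) hFH

/-- Real generators of a finite union of alcoved polyhedra that is bounded in Hilbert's
seminorm. -/
theorem IsAlcovedUnion.exists_real_generators {C : Set (Fin n → ℝ)} (hC : IsAlcovedUnion C)
    (hcone : IsAdditiveCone C) (hne : C.Nonempty) {R : ℝ} (hR : ∀ x ∈ C, ∀ i j, x i - x j ≤ R) :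
    ∃ E : Set (Fin n → ℝ), E.Finite ∧ E ⊆ C ∧
      ∀ f ∈ C, ∀ i, ∃ u ∈ E, u i = 0 ∧ ∀ j, u j + f i ≤ f j := by
  obtain ⟨U, hUf, hU, hbot, h⟩ := hC.exists_generators
  refine ⟨toMax ⁻¹' U, hUf.preimage (Function.Injective.injOn fun x y hxy => funext fun i =>
    WithBot.coe_injective (congrFun hxy i)), fun x hx =>
    mem_of_toMax_mem_tropLowerClosure hC.isClosed (hU hx), fun f hf i => ?_⟩
  obtain ⟨u, hu, hui, hle⟩ := h f hf i
  obtain ⟨w, rfl⟩ := mem_range_toMax_of_bounded hcone hne hR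
    (tropLowerClosure_mono (subset_maxHull hcone) (hU hu)) (hbot u hu)
  exact ⟨w, hu, WithBot.coe_injective hui, fun j => WithBot.coe_le_coe.1 (hle j)⟩

theorem IsAmbitropicalPolytope.exists_isAmbitropicalHull {F : Set (Fin n → ℝ)}
    (hF : IsAmbitropicalPolytope F) : ∃ E : Set (Fin n → ℝ), E.Finite ∧ IsAmbitropicalHull E F := by
  obtain ⟨⟨hamb, hU : IsAlcovedUnion F⟩, R, hR⟩ := hF
  have hR' : ∀ x ∈ F, ∀ i j, x i - x j ≤ R := fun x hx i j =>
    (sub_le_hilbertSeminorm x i j).trans (hR x hx)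
  obtain ⟨A, hAf, hAF, hA⟩ := hU.exists_real_generators hamb.2.1 hamb.1 hR'
  obtain ⟨B, hBf, hBF, hB⟩ := hU.neg.exists_real_generators hamb.2.1.neg hamb.1.neg (R := R)
    fun x hx i j => by
      have := hR' _ hx j i
      simp only [Pi.neg_apply] at this
      linarith
  -- `A` touches each point of F from below and `-B` from above, so any closed ambitropical cone
  -- containing both contains F.
  refine ⟨A ∪ -B, hAf.union (Set.finite_neg.2 hBf), ⟨hU.isClosed, hamb,
    Set.union_subset hAF (Set.neg_subset.2 hBF)⟩, ?_⟩
  rintro G ⟨hGcl, hG, hEG⟩ - x hx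
  refine mem_of_approximations hGcl hG (fun i ε hε => ?_) fun i ε hε => ?_
  · obtain ⟨u, hu, hui, hle⟩ := hA x hx i
    refine ⟨_, hG.2.1 u (hEG (Or.inl hu)) (x i), fun j => ?_, ?_⟩
    · have := hle j
      linarith
    · linarith
  · obtain ⟨u, hu, hui, hle⟩ := hB (-x) (by simpa using hx) i
    refine ⟨_, hG.2.1 (-u) (hEG (Or.inr (by simpa using hu))) (x i), fun j => ?_, ?_⟩
    · have := hle j
      simp only [Pi.neg_apply] at this ⊢
      linarith
    · simp only [Pi.neg_apply]
      linarith

theorem exists_isAmbitropicalHull_of_isEmpty [IsEmpty (Fin n)] (E : Set (Fin n → ℝ)) :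
    ∃ H : Set (Fin n → ℝ), IsAmbitropicalHull E H ∧ IsAmbitropicalPolytope H := by
  have hamb : IsAmbitropicalCone (Set.univ : Set (Fin n → ℝ)) :=
    ⟨Set.univ_nonempty, fun _ _ _ => trivial, fun x y =>
      ⟨⟨x, fun _ _ => (Subsingleton.elim _ _).le, fun _ _ => (Subsingleton.elim _ _).le⟩,
        ⟨x, fun _ _ => (Subsingleton.elim _ _).le, fun _ _ => (Subsingleton.elim _ _).le⟩⟩⟩
  refine ⟨Set.univ, ⟨⟨isClosed_univ, hamb, Set.subset_univ _⟩, fun F hF _ x _ => ?_⟩,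
    ⟨hamb, isAlcovedPolyhedron_univ.isAlcovedUnion⟩, 0, fun x _ => by simp [hilbertSeminorm]⟩
  obtain ⟨f, hf⟩ := hF.2.1.1
  exact Subsingleton.elim f x ▸ hf

theorem exists_isAmbitropicalHull_of_finite {E : Set (Fin n → ℝ)} (hE : E.Finite) :
    ∃ H : Set (Fin n → ℝ), IsAmbitropicalHull E H ∧ IsAmbitropicalPolytope H := by
  rcases isEmpty_or_nonempty (Fin n) with _ | _
  · exact exists_isAmbitropicalHull_of_isEmpty E
  · lift E to Finset (Fin n → ℝ) using hE
    rcases E.eq_empty_or_nonempty with rfl | hs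
    · simpa using exists_isAmbitropicalHull_empty
    · exact ⟨_, isAmbitropicalHull_retractHull hs, isAmbitropicalPolytope_retractHull hs⟩

end PolytopeHulls

end Ambitropical

theorem mainTheorem12 (n : ℕ) :
    (∀ C : Set (Fin n → ℝ), IsClosed C → Ambitropical.IsAmbitropicalCone C →
      (Ambitropical.IsAmbitropicalPolyhedron C ↔
        ∃ (U : Set (Fin n → WithBot ℝ)) (V : Set (Fin n → WithTop ℝ)),
          Ambitropical.IsFiniteDescription C U V) ∧
      (Ambitropical.IsAmbitropicalPolytope C ↔
        ∃ (U : Set (Fin n → WithBot ℝ)) (V : Set (Fin n → WithTop ℝ)),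
          Ambitropical.IsFiniteDescription C U V ∧
          U ⊆ Set.range Ambitropical.toMax ∧ V ⊆ Set.range Ambitropical.toMin) ∧
      (∀ (U : Set (Fin n → WithBot ℝ)) (V : Set (Fin n → WithTop ℝ)),
        Ambitropical.IsFiniteDescription C U V →
          (Ambitropical.IsAmbitropicalPolytope C ↔
            (∀ u ∈ U, u ≠ ⊥ → u ∈ Set.range Ambitropical.toMax) ∧
            (∀ v ∈ V, v ≠ ⊤ → v ∈ Set.range Ambitropical.toMin)))) ∧
    (∀ E : Set (Fin n → ℝ), E.Finite →
      ∃ H : Set (Fin n → ℝ),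
        Ambitropical.IsAmbitropicalHull E H ∧ Ambitropical.IsAmbitropicalPolytope H) ∧
    (∀ F : Set (Fin n → ℝ), Ambitropical.IsAmbitropicalPolytope F →
      ∃ E : Set (Fin n → ℝ), E.Finite ∧ Ambitropical.IsAmbitropicalHull E F) := by
  refine ⟨fun C hcl hC => ⟨?_, ?_, fun U V h => ?_⟩, fun E hE => ?_, fun F hF => ?_⟩
  · exact Ambitropical.isAmbitropicalPolyhedron_iff_exists_isFiniteDescription hcl hC
  · exact Ambitropical.isAmbitropicalPolytope_iff_exists_isFiniteDescription hcl hC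
  · exact h.isAmbitropicalPolytope_iff hcl hC
  · exact Ambitropical.exists_isAmbitropicalHull_of_finite hE
  · exact hF.exists_isAmbitropicalHull
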